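/- Let $d\ge 3$ and let $H=(V,E)$ be a finite $(d+1)$-uniform hypergraph that is linear, i.e. any two distinct hyperedges share at most one vertex. Then $H$ is PL embeddable in $\mathbb{R}^d$. That is, let $\mathsf K$ be the simplicial complex whose faces are the nonempty subsets of the hyperedges of $H$ (so that the maximal faces of $\mathsf K$ are exactly the hyperedges of $H$). Then there is a simplicial subdivision $\mathsf L$ of the geometric realization of $\mathsf K$, and a map $\varphi$ from the vertex set of $\mathsf L$ to $\mathbb{R}^d$, such that for every face $s$ of $\mathsf L$ the points $\varphi(v)$, $v\in s$, are affinely independent, and $$\operatorname{conv}(\varphi(s))\cap\operatorname{conv}(\varphi(t))=\operatorname{conv}(\varphi(s\cap t))\qquad\text{for all faces } s,t \text{ of } \mathsf L .$$ Here a simplicial subdivision of $\mathsf K$ is a simplicial complex $\mathsf L$ such that every simplex of $\mathsf L$ is contained in a simplex of $\mathsf K$ and every simplex of $\mathsf K$ is the union of finitely many simplices of $\mathsf L$. -/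

import Mathlib

namespace HypergraphPL

open Hypergraph

/-- Every hyperedge has exactly `k` vertices. -/
def IsUniform {α : Type*} (H : Hypergraph α) (k : ℕ) : Prop :=
  ∀ e ∈ E(H), e.encard = k

/-- Any two distinct hyperedges share at most one vertex. -/
def IsLinear {α : Type*} (H : Hypergraph α) : Prop :=
  ∀ e ∈ E(H), ∀ f ∈ E(H), e ≠ f → (e ∩ f).encard ≤ 1

/-- The abstract simplicial complex generated by the hyperedges of `H`: its faces are the nonempty
finite subsets of hyperedges. For a uniform hypergraph (of positive uniformity), its maximal faces
are exactly the hyperedges. -/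
def complex {α : Type*} (H : Hypergraph α) : PreAbstractSimplicialComplex α where
  faces := {s | s.Nonempty ∧ ∃ e ∈ E(H), (s : Set α) ⊆ e}
  isRelLowerSet_faces := by
    rintro s ⟨hs, e, he, hse⟩
    exact ⟨hs, fun t hts ht => ⟨ht, e, he, (Finset.coe_subset.2 hts).trans hse⟩⟩

open Classical in
/-- The standard geometric realization: the vertex `v` is placed at the basis vector `single v 1`
of the real vector space with basis `α`, and each face becomes the simplex that it spans. -/
noncomputable def realization {α : Type*} (K : PreAbstractSimplicialComplex α) :
    Geometry.SimplicialComplex ℝ (α →₀ ℝ) :=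
  Geometry.SimplicialComplex.onFinsupp K

/-- `L` is a simplicial subdivision of `K`: every simplex of `L` lies in a simplex of `K`, and every
simplex of `K` is the union of finitely many simplices of `L`. -/
def IsSubdivision {F : Type*} [AddCommGroup F] [Module ℝ F]
    (L K : Geometry.SimplicialComplex ℝ F) : Prop :=
  (∀ s ∈ L.faces, ∃ t ∈ K.faces, convexHull ℝ (s : Set F) ⊆ convexHull ℝ (t : Set F)) ∧
  (∀ t ∈ K.faces, ∃ S : Set (Finset F), S.Finite ∧ S ⊆ L.faces ∧
    convexHull ℝ (t : Set F) = ⋃ s ∈ S, convexHull ℝ (s : Set F))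

/-- An abstract simplicial complex is geometrically (linearly) embeddable in `ℝ^d` if its vertices
can be placed in `ℝ^d` so that the vertices of each face are affinely independent and any two of
the resulting simplices meet exactly in the simplex spanned by their common vertices. Applying the
second condition to vertices shows that `φ` is injective on the vertex set of `K`. -/
def GeometricallyEmbeddable {β : Type*} (K : PreAbstractSimplicialComplex β) (d : ℕ) : Prop :=
  ∃ φ : β → EuclideanSpace ℝ (Fin d),
    (∀ s ∈ K.faces, AffineIndependent ℝ (fun v : s => φ v)) ∧
    (∀ s ∈ K.faces, ∀ t ∈ K.faces,
      convexHull ℝ (φ '' (s : Set β)) ∩ convexHull ℝ (φ '' (t : Set β)) =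
        convexHull ℝ (φ '' ((s : Set β) ∩ (t : Set β))))

/-- An abstract simplicial complex is PL embeddable in `ℝ^d` if some simplicial subdivision of (the
geometric realization of) it is geometrically embeddable in `ℝ^d`. -/
def PLEmbeddable {α : Type*} (K : PreAbstractSimplicialComplex α) (d : ℕ) : Prop :=
  ∃ L : Geometry.SimplicialComplex ℝ (α →₀ ℝ),
    IsSubdivision L (realization K) ∧
      GeometricallyEmbeddable L.toPreAbstractSimplicialComplex d

end HypergraphPL

/-! Take the barycentric subdivision, whose faces correspond to flags of nonempty subsets of
hyperedges. Linearity puts each `F` with at least two elements in a unique hyperedge, its carrier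
`e`. Move the barycenter of `F` to `(1 - ε) • bary e + ε • bary F` and fix the vertices: each
simplex shrinks to a thin neighbourhood of the segments from its barycenter to its vertices. This is
still injective in `α →₀ ℝ` (`IsFlag.uniqueConvexCombinations_spike`).

Then project to `ℝ^d` by a generic linear map (`exists_generic_projection`). It is injective on each
`d`-dimensional simplex and, because `3 ≤ d`, keeps two vertices and the barycenters of two distinct
hyperedges affinely independent. Hence segments belonging to distinct hyperedges meet only at a
common vertex, and by compactness this persists for small `ε > 0` (`eventually_affineIndependent`,
`exists_uniqueConvexCombinations`). -/

namespace HypergraphPL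

open Module Filter Topology

/-! ### Convex combinations with unique weights. -/

section ConvexCombinations

variable {ι E : Type*} [AddCommGroup E] [Module ℝ E]

theorem sum_eq_linearCombination (y : ι →₀ ℝ) :
    (y.sum fun _ r => r) = Finsupp.linearCombination ℝ (fun _ => (1 : ℝ)) y := by
  simp [Finsupp.linearCombination_apply]

theorem mem_convexHull_image_single_iff {s : Set ι} {x : ι →₀ ℝ} :
    x ∈ convexHull ℝ ((fun i => Finsupp.single i (1 : ℝ)) '' s) ↔
      (∀ i, 0 ≤ x i) ∧ (x.support : Set ι) ⊆ s ∧ (x.sum fun _ r => r) = 1 := by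
  constructor
  · intro hx
    have hsupp : ∀ y : ι →₀ ℝ, (y.support : Set ι) ⊆ s ↔ ∀ i ∉ s, y i = 0 := fun y => by
      constructor
      · intro h i hi
        by_contra hne
        exact hi (h (by simpa using hne))
      · intro h i hi
        by_contra hne
        exact (Finsupp.mem_support_iff.1 hi) (h i hne)
    refine convexHull_min (t := {y : ι →₀ ℝ | (∀ i, 0 ≤ y i) ∧ (y.support : Set ι) ⊆ s ∧
      (y.sum fun _ r => r) = 1}) ?_ ?_ hx
    · rintro _ ⟨i, hi, rfl⟩
      refine ⟨fun j => ?_, (hsupp _).2 fun j hj => ?_, by simp⟩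
      · by_cases h : i = j <;> simp [h]
      · exact Finsupp.single_eq_of_ne (by rintro rfl; exact hj hi)
    · rintro y ⟨hy, hys, hy1⟩ z ⟨hz, hzs, hz1⟩ a b ha hb hab
      rw [sum_eq_linearCombination] at hy1 hz1
      refine ⟨fun i => ?_, (hsupp _).2 fun i hi => ?_, ?_⟩
      · simp only [Finsupp.add_apply, Finsupp.smul_apply, smul_eq_mul]
        have := hy i
        have := hz i
        positivity
      · simp [(hsupp _).1 hys i hi, (hsupp _).1 hzs i hi]
      · rw [sum_eq_linearCombination, map_add, map_smul, map_smul, hy1, hz1]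
        simpa using hab
  · rintro ⟨hx, hs, h1⟩
    have hx' : x = ∑ i ∈ x.support, x i • Finsupp.single i (1 : ℝ) := by
      conv_lhs => rw [← Finsupp.sum_single x]
      simp [Finsupp.sum]
    rw [hx']
    exact (convex_convexHull ℝ _).sum_mem (fun i _ => hx i) h1
      fun i hi => subset_convexHull ℝ _ ⟨i, hs hi, rfl⟩

/-- Convex combinations of a family indexed by finitely supported weights. -/
theorem mem_convexHull_image_iff {u : ι → E} {s : Set ι} {x : E} :
    x ∈ convexHull ℝ (u '' s) ↔ ∃ w : ι →₀ ℝ, (∀ i, 0 ≤ w i) ∧ (w.support : Set ι) ⊆ s ∧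
      (w.sum fun _ r => r) = 1 ∧ Finsupp.linearCombination ℝ u w = x := by
  have : u '' s = Finsupp.linearCombination ℝ u '' ((fun i => Finsupp.single i (1 : ℝ)) '' s) := by
    rw [Set.image_image]
    simp
  rw [this, ← LinearMap.image_convexHull]
  simp only [Set.mem_image, mem_convexHull_image_single_iff, and_assoc]

/-- Convex combinations over `s` and over `t` agree only if their weights agree. -/
def UniqueConvexCombinations (u : ι → E) (s t : Set ι) : Prop :=
  ∀ v w : ι →₀ ℝ, (∀ i, 0 ≤ v i) → (v.support : Set ι) ⊆ s → (v.sum fun _ r => r) = 1 →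
    (∀ i, 0 ≤ w i) → (w.support : Set ι) ⊆ t → (w.sum fun _ r => r) = 1 →
    Finsupp.linearCombination ℝ u v = Finsupp.linearCombination ℝ u w → v = w

theorem UniqueConvexCombinations.convexHull_inter {u : ι → E} {s t : Set ι}
    (h : UniqueConvexCombinations u s t) :
    convexHull ℝ (u '' s) ∩ convexHull ℝ (u '' t) = convexHull ℝ (u '' (s ∩ t)) := by
  apply subset_antisymm
  · rintro x ⟨hs, ht⟩
    obtain ⟨v, hv, hvs, hv1, rfl⟩ := mem_convexHull_image_iff.1 hs
    obtain ⟨w, hw, hwt, hw1, hvw⟩ := mem_convexHull_image_iff.1 ht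
    obtain rfl := h v w hv hvs hv1 hw hwt hw1 hvw.symm
    exact mem_convexHull_image_iff.2 ⟨v, hv, Set.subset_inter hvs hwt, hv1, rfl⟩
  · exact Set.subset_inter (convexHull_mono (Set.image_mono Set.inter_subset_left))
      (convexHull_mono (Set.image_mono Set.inter_subset_right))

/-- A Radon partition of a dependent family would express one point by two weight vectors with
disjoint supports; being equal, both would vanish, yet they sum to one. -/
theorem UniqueConvexCombinations.affineIndependent {u : ι → E} {s : Set ι}
    (h : UniqueConvexCombinations u s s) : AffineIndependent ℝ fun i : s => u i := by
  by_contra hn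
  obtain ⟨I, x, hx, hy⟩ := Convex.radon_partition hn
  have hI : ∀ J : Set s, (fun i : s => u i) '' J = u '' (Subtype.val '' J) := fun J => by
    rw [Set.image_image]
  rw [hI] at hx hy
  obtain ⟨v, hv, hvs, hv1, rfl⟩ := mem_convexHull_image_iff.1 hx
  obtain ⟨w, hw, hwt, hw1, hvw⟩ := mem_convexHull_image_iff.1 hy
  obtain rfl := h v w hv (hvs.trans (by simp)) hv1 hw (hwt.trans (by simp)) hw1 hvw.symm
  have : v = 0 := by
    rw [← Finsupp.support_eq_empty, ← Finset.coe_eq_empty]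
    refine Set.eq_empty_of_forall_notMem fun i hi => ?_
    obtain ⟨a, ha, rfl⟩ := hvs hi
    obtain ⟨b, hb, hab⟩ := hwt hi
    exact hb (by rwa [Subtype.ext hab])
  simp [this] at hv1

end ConvexCombinations

/-! ### Generic linear maps. -/

section GenericProjection

variable {ι E : Type*} [AddCommGroup E] [Module ℝ E]

/-- A functional that is nonzero on a chosen vector of each nonzero `W i` has a kernel that lowers
every positive dimension. It serves as the first coordinate, and induction on `d` supplies the
others. -/
theorem exists_linearMap_pi_injective_on [Finite ι] (d : ℕ) (W : ι → Submodule ℝ E)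
    [∀ i, FiniteDimensional ℝ (W i)] (hW : ∀ i, finrank ℝ (W i) ≤ d) :
    ∃ T : E →ₗ[ℝ] (Fin d → ℝ), ∀ i, ∀ x ∈ W i, T x = 0 → x = 0 := by
  induction d generalizing W with
  | zero =>
    refine ⟨0, fun i x hx _ => ?_⟩
    have := Submodule.finrank_eq_zero.1 (Nat.le_zero.1 (hW i))
    simpa [this] using hx
  | succ d ih =>
    have hx : ∀ i : {i // W i ≠ ⊥}, ∃ x ∈ W i, x ≠ 0 := fun i => Submodule.exists_mem_ne_zero_of_ne_bot i.2
    choose x hxW hx0 using hx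
    obtain ⟨f, hf⟩ := Module.exists_dual_forall_apply_ne_zero (K := ℝ) x hx0
    obtain ⟨T, hT⟩ := ih (fun i => W i ⊓ LinearMap.ker f) fun i => by
      have hle : finrank ℝ ↥(W i ⊓ LinearMap.ker f) ≤ finrank ℝ (W i) :=
        Submodule.finrank_mono inf_le_left
      by_cases hi : W i = ⊥
      · have : finrank ℝ (W i) = 0 := Submodule.finrank_eq_zero.2 hi
        exact hle.trans (by omega)
      · have : W i ⊓ LinearMap.ker f < W i := by
          refine lt_of_le_of_ne inf_le_left fun h => hf ⟨i, hi⟩ ?_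
          have := hxW ⟨i, hi⟩
          rw [← h] at this
          exact this.2
        have := Submodule.finrank_lt_finrank_of_lt this
        have := hW i
        omega
    refine ⟨LinearMap.pi (Fin.cons f fun j => LinearMap.proj j ∘ₗ T), fun i y hy hTy => ?_⟩
    refine hT i y ⟨hy, ?_⟩ ?_
    · simpa using congrFun hTy 0
    · ext j
      simpa using congrFun hTy j.succ

theorem exists_linearMap_injective_on [Finite ι] (d : ℕ) (W : ι → Submodule ℝ E)
    [∀ i, FiniteDimensional ℝ (W i)] (hW : ∀ i, finrank ℝ (W i) ≤ d) :
    ∃ T : E →ₗ[ℝ] EuclideanSpace ℝ (Fin d), ∀ i, ∀ x ∈ W i, T x = 0 → x = 0 := by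
  obtain ⟨T, hT⟩ := exists_linearMap_pi_injective_on d W hW
  refine ⟨(WithLp.linearEquiv 2 ℝ (Fin d → ℝ)).symm.toLinearMap ∘ₗ T, fun i x hx h => hT i x hx ?_⟩
  simpa using h

theorem AffineIndependent.map_of_injective_on_vectorSpan {F : Type*} [AddCommGroup F] [Module ℝ F]
    {κ : Type*} {p : κ → E} (hp : AffineIndependent ℝ p) (T : E →ₗ[ℝ] F)
    (hT : ∀ x ∈ vectorSpan ℝ (Set.range p), T x = 0 → x = 0) :
    AffineIndependent ℝ fun i => T (p i) := by
  rcases isEmpty_or_nonempty κ with h | ⟨⟨i₀⟩⟩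
  · exact affineIndependent_of_subsingleton ℝ _
  rw [affineIndependent_iff_linearIndependent_vsub ℝ _ i₀] at hp ⊢
  have := hp.map (f := T) (by
    rw [Submodule.disjoint_def]
    intro x hx hx0
    refine hT x ?_ hx0
    refine Submodule.span_le.2 ?_ hx
    rintro _ ⟨i, rfl⟩
    exact vsub_mem_vectorSpan ℝ ⟨_, rfl⟩ ⟨_, rfl⟩)
  convert! this using 1
  ext i
  simp

end GenericProjection

/-! ### Barycenters and the weights of flags. -/

section Barycenters

variable {α : Type*}

/-- The barycenter of the face spanned by the basis vectors in `F`. -/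
noncomputable def bary (F : Finset α) : α →₀ ℝ :=
  ∑ v ∈ F, Finsupp.single v (F.card : ℝ)⁻¹

open Classical in
theorem bary_apply (F : Finset α) (v : α) : bary F v = if v ∈ F then (F.card : ℝ)⁻¹ else 0 := by
  simp [bary, Finsupp.finsetSum_apply, Finsupp.single_apply]

theorem bary_apply_of_mem {F : Finset α} {v : α} (h : v ∈ F) : bary F v = (F.card : ℝ)⁻¹ := by
  simp [bary_apply, h]

theorem bary_apply_of_notMem {F : Finset α} {v : α} (h : v ∉ F) : bary F v = 0 := by
  simp [bary_apply, h]

theorem bary_nonneg (F : Finset α) (v : α) : 0 ≤ bary F v := by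
  rw [bary_apply]
  split_ifs <;> positivity

theorem bary_pos {F : Finset α} {v : α} (h : v ∈ F) : 0 < bary F v := by
  have : 0 < F.card := Finset.card_pos.2 ⟨v, h⟩
  rw [bary_apply_of_mem h]
  positivity

@[simp]
theorem support_bary (F : Finset α) : (bary F).support = F := by
  ext v
  by_cases h : v ∈ F
  · simp [h, (bary_pos h).ne']
  · simp [h, bary_apply_of_notMem h]

theorem bary_injective : Function.Injective (bary : Finset α → α →₀ ℝ) :=
  Function.LeftInverse.injective support_bary

@[simp]
theorem bary_singleton (v : α) : bary {v} = Finsupp.single v 1 := by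
  simp [bary]

theorem bary_mem_convexHull {F G : Finset α} (hF : F.Nonempty) (h : F ⊆ G) :
    bary F ∈ convexHull ℝ ((fun i => Finsupp.single i (1 : ℝ)) '' (G : Set α)) := by
  refine mem_convexHull_image_single_iff.2 ⟨bary_nonneg F, by simpa using h, ?_⟩
  have : (F.card : ℝ) ≠ 0 := by exact_mod_cast hF.card_pos.ne'
  rw [Finsupp.sum, support_bary, Finset.sum_congr rfl fun v hv => bary_apply_of_mem hv]
  simp [this]

theorem linearCombination_bary_apply (w : Finset α →₀ ℝ) (v : α) :
    Finsupp.linearCombination ℝ bary w v = ∑ F ∈ w.support, w F * bary F v := by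
  simp [Finsupp.linearCombination_apply, Finsupp.sum, Finsupp.finsetSum_apply]

theorem exists_max_of_isChain {C : Finset (Finset α)} (hC : IsChain (· ⊆ ·) (C : Set (Finset α)))
    (hne : C.Nonempty) : ∃ G ∈ C, ∀ F ∈ C, F ⊆ G := by
  obtain ⟨G, hG, hmax⟩ := C.exists_max_image Finset.card hne
  refine ⟨G, hG, fun F hF => ?_⟩
  rcases hC.total hF hG with h | h
  · exact h
  · exact (Finset.eq_of_subset_of_card_le h (hmax F hF)).ge

theorem support_linearCombination_bary {w : Finset α →₀ ℝ} (hw : ∀ F, 0 ≤ w F) {G : Finset α}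
    (hG : G ∈ w.support) (hmax : ∀ F ∈ w.support, F ⊆ G) :
    (Finsupp.linearCombination ℝ bary w).support = G := by
  ext v
  rw [Finsupp.mem_support_iff, linearCombination_bary_apply]
  constructor
  · contrapose!
    exact fun hv => Finset.sum_eq_zero fun F hF => by
      rw [bary_apply_of_notMem fun h => hv (hmax F hF h), mul_zero]
  · intro hv
    refine (Finset.sum_pos' (fun F _ => mul_nonneg (hw F) (bary_nonneg F v)) ⟨G, hG, ?_⟩).ne'
    exact mul_pos ((hw G).lt_of_ne' (Finsupp.mem_support_iff.1 hG)) (bary_pos hv)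

/-- Nonnegative combinations of the barycenters of a flag of nonempty faces have unique weights,
and these determine the flag. -/
theorem linearCombination_bary_injective {v w : Finset α →₀ ℝ} (hv : ∀ F, 0 ≤ v F)
    (hvC : IsChain (· ⊆ ·) (v.support : Set (Finset α))) (hvn : ∀ F ∈ v.support, F.Nonempty)
    (hw : ∀ F, 0 ≤ w F) (hwC : IsChain (· ⊆ ·) (w.support : Set (Finset α)))
    (hwn : ∀ F ∈ w.support, F.Nonempty)
    (h : Finsupp.linearCombination ℝ bary v = Finsupp.linearCombination ℝ bary w) : v = w := by
  classical
  induction hn : v.support.card + w.support.card using Nat.strong_induction_on generalizing v w with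
  | _ n ih =>
  have hzero : ∀ u : Finset α →₀ ℝ, (∀ F, 0 ≤ u F) → IsChain (· ⊆ ·) (u.support : Set (Finset α)) →
      (∀ F ∈ u.support, F.Nonempty) → Finsupp.linearCombination ℝ bary u = 0 → u = 0 := by
    intro u hu huC hun h0
    by_contra hne
    obtain ⟨G, hG, hmax⟩ := exists_max_of_isChain huC (Finsupp.support_nonempty_iff.2 hne)
    have := support_linearCombination_bary hu hG hmax
    rw [h0, Finsupp.support_zero] at this
    exact (hun G hG).ne_empty this.symm
  rcases eq_or_ne v 0 with rfl | hv0
  · exact (hzero w hw hwC hwn (by simpa using h.symm)).symm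
  rcases eq_or_ne w 0 with rfl | hw0
  · exact hzero v hv hvC hvn (by simpa using h)
  obtain ⟨G, hG, hGmax⟩ := exists_max_of_isChain hvC (Finsupp.support_nonempty_iff.2 hv0)
  obtain ⟨G', hG', hGmax'⟩ := exists_max_of_isChain hwC (Finsupp.support_nonempty_iff.2 hw0)
  -- The largest member of either flag is the support of the common combination.
  obtain rfl : G = G' := by
    rw [← support_linearCombination_bary hv hG hGmax, h,
      support_linearCombination_bary hw hG' hGmax']
  -- Subtracting the smaller of the two top weights removes `G` from at least one support, so the
  -- total support size drops.
  set m := min (v G) (w G) with hm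
  have hsub : ∀ u : Finset α →₀ ℝ, G ∈ u.support → (u - Finsupp.single G m).support ⊆ u.support := by
    intro u hu F hF
    rcases eq_or_ne F G with rfl | hne
    · exact hu
    · simpa [hne] using hF
  have hnonneg : ∀ u : Finset α →₀ ℝ, (∀ F, 0 ≤ u F) → m ≤ u G →
      ∀ F, 0 ≤ (u - Finsupp.single G m) F := by
    intro u hu hle F
    rcases eq_or_ne F G with rfl | hne
    · simpa using hle
    · simpa [hne] using hu F
  have hlt : ∀ u : Finset α →₀ ℝ, G ∈ u.support → m = u G →
      (u - Finsupp.single G m).support.card < u.support.card := by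
    intro u hu he
    refine Finset.card_lt_card ⟨hsub u hu, fun hs => ?_⟩
    simpa [he] using hs hu
  have hcard : (v - Finsupp.single G m).support.card + (w - Finsupp.single G m).support.card < n := by
    have h1 := Finset.card_le_card (hsub v hG)
    have h2 := Finset.card_le_card (hsub w hG')
    rcases min_choice (v G) (w G) with h3 | h3
    · have := hlt v hG (hm.trans h3)
      omega
    · have := hlt w hG' (hm.trans h3)
      omega
  have := ih _ hcard (v := v - Finsupp.single G m) (w := w - Finsupp.single G m)
    (hnonneg v hv (min_le_left _ _)) (hvC.mono (by exact_mod_cast hsub v hG))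
    (fun F hF => hvn F (hsub v hG hF))
    (hnonneg w hw (min_le_right _ _)) (hwC.mono (by exact_mod_cast hsub w hG'))
    (fun F hF => hwn F (hsub w hG' hF)) (by rw [map_sub, map_sub, h]) rfl
  simpa using this

/-- Every nonnegative vector is a nonnegative combination of the barycenters of a flag. -/
theorem exists_linearCombination_bary (x : α →₀ ℝ) (hx : ∀ i, 0 ≤ x i) :
    ∃ w : Finset α →₀ ℝ, (∀ F, 0 ≤ w F) ∧ IsChain (· ⊆ ·) (w.support : Set (Finset α)) ∧
      (∀ F ∈ w.support, F.Nonempty ∧ F ⊆ x.support) ∧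
      Finsupp.linearCombination ℝ bary w = x := by
  classical
  induction hn : x.support.card using Nat.strong_induction_on generalizing x with
  | _ n ih =>
  rcases eq_or_ne x 0 with rfl | hx0
  · exact ⟨0, by simp⟩
  set G := x.support with hG
  have hGn : G.Nonempty := Finsupp.support_nonempty_iff.2 hx0
  -- Subtracting `(x i * G.card) • bary G` lowers every coordinate on the support by the least one,
  -- `x i`: nonnegativity survives and `i` leaves the support.
  obtain ⟨i, hi, hmin⟩ := G.exists_min_image x hGn
  have hcard : (0 : ℝ) < G.card := by exact_mod_cast hGn.card_pos
  have hin : ∀ j ∈ G, (x - (x i * G.card) • bary G) j = x j - x i := fun j hj => by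
    simp [bary_apply_of_mem hj, hcard.ne']
  have hout : ∀ j ∉ G, (x - (x i * G.card) • bary G) j = 0 := fun j hj => by
    simp [bary_apply_of_notMem hj, Finsupp.notMem_support_iff.1 hj]
  have hsub : (x - (x i * G.card) • bary G).support ⊆ G := fun j hj => by
    by_contra h
    exact Finsupp.mem_support_iff.1 hj (hout j h)
  have hi' : i ∉ (x - (x i * G.card) • bary G).support := by
    rw [Finsupp.notMem_support_iff, hin i hi, sub_self]
  obtain ⟨w, hw, hC, hs, hl⟩ := ih _ (hn ▸ Finset.card_lt_card ⟨hsub, fun h => hi' (h hi)⟩)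
    (x - (x i * G.card) • bary G) (fun j => by
      by_cases hj : j ∈ G
      · rw [hin j hj]
        exact sub_nonneg.2 (hmin j hj)
      · rw [hout j hj]) rfl
  have hsupp : ∀ F ∈ (w + Finsupp.single G (x i * G.card)).support, F = G ∨ F ∈ w.support := by
    intro F hF
    rcases Finset.mem_union.1 (Finsupp.support_add hF) with h | h
    · exact Or.inr h
    · exact Or.inl (Finset.mem_singleton.1 (Finsupp.support_single_subset h))
  refine ⟨w + Finsupp.single G (x i * G.card), fun F => ?_, ?_, fun F hF => ?_, ?_⟩
  · have h1 := hw F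
    have h2 : 0 ≤ Finsupp.single G (x i * G.card) F := by
      have := hx i
      rw [Finsupp.single_apply]
      split_ifs <;> positivity
    exact add_nonneg h1 h2
  · refine (hC.insert (a := G) fun F hF _ => Or.inr ((hs F hF).2.trans hsub)).mono fun F hF => ?_
    exact hsupp F hF
  · rcases hsupp F hF with rfl | h
    · exact ⟨hGn, subset_rfl⟩
    · exact ⟨(hs F h).1, (hs F h).2.trans hsub⟩
  · rw [map_add, hl, Finsupp.linearCombination_single]
    abel

end Barycenters

/-! ### Flags, carriers and the barycentric subdivision. -/

section Flags

variable {α : Type*} {𝓔 : Set (Finset α)}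

/-- A flag of nonempty subsets of members of `𝓔`. -/
structure IsFlag (𝓔 : Set (Finset α)) (C : Set (Finset α)) : Prop where
  isChain : IsChain (· ⊆ ·) C
  nonempty : ∀ F ∈ C, F.Nonempty
  subset_edge : ∀ F ∈ C, ∃ e ∈ 𝓔, F ⊆ e

theorem IsFlag.mono {C D : Set (Finset α)} (hD : IsFlag 𝓔 D) (h : C ⊆ D) : IsFlag 𝓔 C :=
  ⟨hD.isChain.mono h, fun F hF => hD.nonempty F (h hF), fun F hF => hD.subset_edge F (h hF)⟩

theorem IsFlag.uniqueConvexCombinations_bary {C D : Set (Finset α)} (hC : IsFlag 𝓔 C)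
    (hD : IsFlag 𝓔 D) : UniqueConvexCombinations bary C D :=
  fun _ _ hv hvs _ hw hws _ h => linearCombination_bary_injective hv (hC.isChain.mono hvs)
    (fun F hF => hC.nonempty F (hvs hF)) hw (hD.isChain.mono hws)
    (fun F hF => hD.nonempty F (hws hF)) h

open Classical in
/-- The member of `𝓔` containing `F` if `F` has at least two elements, and `F` otherwise. -/
noncomputable def carrier (𝓔 : Set (Finset α)) (F : Finset α) : Finset α :=
  if h : 1 < F.card ∧ ∃ e ∈ 𝓔, F ⊆ e then h.2.choose else F

/-- No two members of `𝓔` share two elements. -/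
def IsLinearFamily (𝓔 : Set (Finset α)) : Prop :=
  ∀ ⦃e⦄, e ∈ 𝓔 → ∀ ⦃f⦄, f ∈ 𝓔 → ∀ ⦃F : Finset α⦄, 1 < F.card → F ⊆ e → F ⊆ f → e = f

theorem carrier_of_card_le {F : Finset α} (h : F.card ≤ 1) : carrier 𝓔 F = F :=
  dif_neg fun h' => h'.1.not_ge h

theorem IsLinearFamily.carrier_eq (h𝓔 : IsLinearFamily 𝓔) {F e : Finset α} (h : 1 < F.card)
    (he : e ∈ 𝓔) (hF : F ⊆ e) : carrier 𝓔 F = e := by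
  have h' : 1 < F.card ∧ ∃ e ∈ 𝓔, F ⊆ e := ⟨h, e, he, hF⟩
  rw [carrier, dif_pos h']
  exact h𝓔 h'.2.choose_spec.1 he h h'.2.choose_spec.2 hF

theorem subset_carrier (F : Finset α) : F ⊆ carrier 𝓔 F := by
  rw [carrier]
  split_ifs with h
  · exact h.2.choose_spec.2
  · exact subset_rfl

theorem IsLinearFamily.carrier_carrier (h𝓔 : IsLinearFamily 𝓔) (F : Finset α) :
    carrier 𝓔 (carrier 𝓔 F) = carrier 𝓔 F := by
  by_cases h : 1 < F.card ∧ ∃ e ∈ 𝓔, F ⊆ e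
  · obtain ⟨h1, e, he, hF⟩ := h
    rw [h𝓔.carrier_eq h1 he hF]
    exact h𝓔.carrier_eq (h1.trans_le (Finset.card_le_card hF)) he subset_rfl
  · have : carrier 𝓔 F = F := dif_neg h
    rw [this, this]

theorem carrier_subset_edge {F e : Finset α} (h𝓔 : IsLinearFamily 𝓔) (he : e ∈ 𝓔) (hF : F ⊆ e) :
    carrier 𝓔 F ⊆ e := by
  rcases le_or_gt F.card 1 with h | h
  · rwa [carrier_of_card_le h]
  · rw [h𝓔.carrier_eq h he hF]

theorem carrier_comparable {F G e : Finset α} (h𝓔 : IsLinearFamily 𝓔) (he : e ∈ 𝓔) (hG : G ⊆ e)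
    (hFG : F ⊆ G) : carrier 𝓔 F ⊆ G ∨ G ⊆ carrier 𝓔 F := by
  rcases le_or_gt F.card 1 with h | h
  · rw [carrier_of_card_le h]
    exact Or.inl hFG
  · rw [h𝓔.carrier_eq h he (hFG.trans hG)]
    exact Or.inr hG

theorem carrier_mono {F G e : Finset α} (h𝓔 : IsLinearFamily 𝓔) (he : e ∈ 𝓔) (hG : G ⊆ e)
    (hFG : F ⊆ G) : carrier 𝓔 F ⊆ carrier 𝓔 G := by
  rcases le_or_gt F.card 1 with h | h
  · rw [carrier_of_card_le h]
    exact hFG.trans (subset_carrier G)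
  · rw [h𝓔.carrier_eq h he (hFG.trans hG),
      h𝓔.carrier_eq (h.trans_le (Finset.card_le_card hFG)) he hG]

/-- A singleton is its own carrier; the carrier of a larger member is the hyperedge that contains
every member comparable to it. -/
theorem IsFlag.union_carrier {C : Set (Finset α)} (h𝓔 : IsLinearFamily 𝓔) (hC : IsFlag 𝓔 C) :
    IsFlag 𝓔 (C ∪ carrier 𝓔 '' C) := by
  refine ⟨?_, ?_, ?_⟩
  · have key : ∀ F ∈ C, ∀ G ∈ C, carrier 𝓔 F ⊆ G ∨ G ⊆ carrier 𝓔 F := by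
      intro F hF G hG
      rcases hC.isChain.total hF hG with h | h
      · obtain ⟨e, he, hGe⟩ := hC.subset_edge G hG
        exact carrier_comparable h𝓔 he hGe h
      · exact Or.inr (h.trans (subset_carrier F))
    rintro _ (hF | ⟨F, hF, rfl⟩) _ (hG | ⟨G, hG, rfl⟩) -
    · exact hC.isChain.total hF hG
    · exact (key G hG _ hF).symm
    · exact key F hF _ hG
    · rcases hC.isChain.total hF hG with h | h
      · obtain ⟨e, he, hGe⟩ := hC.subset_edge G hG
        exact Or.inl (carrier_mono h𝓔 he hGe h)
      · obtain ⟨e, he, hFe⟩ := hC.subset_edge F hF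
        exact Or.inr (carrier_mono h𝓔 he hFe h)
  · rintro _ (hF | ⟨F, hF, rfl⟩)
    · exact hC.nonempty _ hF
    · exact (hC.nonempty F hF).mono (subset_carrier F)
  · rintro _ (hF | ⟨F, hF, rfl⟩)
    · exact hC.subset_edge _ hF
    · obtain ⟨e, he, hFe⟩ := hC.subset_edge F hF
      exact ⟨e, he, carrier_subset_edge h𝓔 he hFe⟩

/-- The barycenter of `F`, pushed towards the barycenter of its carrier. For small `ε`, this
turns each maximal simplex into a thin neighbourhood of the segments from its barycenter to its
vertices. -/
noncomputable def spike (𝓔 : Set (Finset α)) (ε : ℝ) (F : Finset α) : α →₀ ℝ :=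
  (1 - ε) • bary (carrier 𝓔 F) + ε • bary F

theorem linearCombination_spike (ε : ℝ) (w : Finset α →₀ ℝ) :
    Finsupp.linearCombination ℝ (spike 𝓔 ε) w = Finsupp.linearCombination ℝ bary
      ((1 - ε) • w.mapDomain (carrier 𝓔) + ε • w) := by
  rw [map_add, map_smul, map_smul, Finsupp.linearCombination_mapDomain]
  simp only [Finsupp.linearCombination_apply, Finsupp.sum, Finset.smul_sum, spike, smul_add,
    Finset.sum_add_distrib, Function.comp]
  congr 1 <;> exact Finset.sum_congr rfl fun _ _ => smul_comm _ _ _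

/-- A combination of spikes is a nonnegative combination of barycenters over the flag enlarged by
its carriers, so uniqueness for flags determines the mixed weights. The original weights must then
be recovered from these. -/
theorem IsFlag.uniqueConvexCombinations_spike {ε : ℝ} (h0 : 0 < ε) (h1 : ε ≤ 1)
    (h𝓔 : IsLinearFamily 𝓔) {C D : Set (Finset α)} (hC : IsFlag 𝓔 C) (hD : IsFlag 𝓔 D) :
    UniqueConvexCombinations (spike 𝓔 ε) C D := by
  classical
  intro v w hv hvs _ hw hws _ h
  rw [linearCombination_spike, linearCombination_spike] at h
  have hnonneg : ∀ u : Finset α →₀ ℝ, (∀ F, 0 ≤ u F) →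
      ∀ F, 0 ≤ ((1 - ε) • u.mapDomain (carrier 𝓔) + ε • u) F := by
    intro u hu F
    have h2 : 0 ≤ u.mapDomain (carrier 𝓔) F := by
      rw [Finsupp.mapDomain, Finsupp.sum_apply]
      refine Finset.sum_nonneg fun G _ => ?_
      change 0 ≤ Finsupp.single (carrier 𝓔 G) (u G) F
      rw [Finsupp.single_apply]
      split_ifs
      exacts [hu G, le_rfl]
    have := hu F
    have := sub_nonneg.2 h1
    simp only [Finsupp.add_apply, Finsupp.smul_apply, smul_eq_mul]
    positivity
  have hsupp : ∀ {B : Set (Finset α)} (u : Finset α →₀ ℝ), (u.support : Set (Finset α)) ⊆ B →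
      (((1 - ε) • u.mapDomain (carrier 𝓔) + ε • u).support : Set (Finset α)) ⊆
        B ∪ carrier 𝓔 '' B := by
    intro B u hu F hF
    rcases Finset.mem_union.1 (Finsupp.support_add hF) with h' | h'
    · have := Finsupp.mapDomain_support (Finsupp.support_smul h')
      obtain ⟨G, hG, rfl⟩ := Finset.mem_image.1 this
      exact Or.inr ⟨G, hu hG, rfl⟩
    · exact Or.inl (hu (Finsupp.support_smul h'))
  have hC' := (hC.union_carrier h𝓔).mono (hsupp v hvs)
  have hD' := (hD.union_carrier h𝓔).mono (hsupp w hws)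
  have heq := linearCombination_bary_injective (hnonneg v hv) hC'.isChain hC'.nonempty
    (hnonneg w hw) hD'.isChain hD'.nonempty h
  have hidem : ∀ u : Finset α →₀ ℝ,
      (u.mapDomain (carrier 𝓔)).mapDomain (carrier 𝓔) = u.mapDomain (carrier 𝓔) := fun u => by
    rw [← Finsupp.mapDomain_comp]
    exact Finsupp.mapDomain_congr fun F _ => h𝓔.carrier_carrier F
  -- As the carrier map is idempotent, pushing the mixed weights forward merges the parts `1 - ε`
  -- and `ε` into the pushforward alone. Cancelling it leaves `ε • v = ε • w`.
  have hmap : v.mapDomain (carrier 𝓔) = w.mapDomain (carrier 𝓔) := by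
    have := congrArg (Finsupp.mapDomain (carrier 𝓔)) heq
    simpa only [Finsupp.mapDomain_add, Finsupp.mapDomain_smul, hidem, ← add_smul, sub_add_cancel,
      one_smul] using this
  rw [hmap] at heq
  exact smul_right_injective _ h0.ne' (add_left_cancel heq)

/-- The barycentric subdivision of the complex generated by `𝓔`. -/
noncomputable def barycentricSubdivision (𝓔 : Set (Finset α)) :
    Geometry.SimplicialComplex ℝ (α →₀ ℝ) where
  faces := {s | s.Nonempty ∧ ∃ C, IsFlag 𝓔 C ∧ (s : Set (α →₀ ℝ)) = bary '' C}
  isRelLowerSet_faces := by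
    rintro s ⟨hs, C, hC, hsC⟩
    refine ⟨hs, fun t hts ht => ⟨ht, {F ∈ C | bary F ∈ t}, hC.mono (Set.sep_subset _ _), ?_⟩⟩
    ext x
    constructor
    · intro hx
      obtain ⟨F, hF, rfl⟩ : x ∈ bary '' C := hsC ▸ hts hx
      exact ⟨F, ⟨hF, hx⟩, rfl⟩
    · rintro ⟨F, ⟨-, hF⟩, rfl⟩
      exact hF
  indep := by
    rintro s ⟨-, C, hC, hsC⟩
    have := (hC.uniqueConvexCombinations_bary hC).affineIndependent.range
    rw [← Set.image_eq_range, ← hsC] at this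
    exact this
  inter_subset_convexHull := by
    rintro s t ⟨-, C, hC, hsC⟩ ⟨-, D, hD, htD⟩
    rw [hsC, htD, ← Set.image_inter bary_injective,
      (hC.uniqueConvexCombinations_bary hD).convexHull_inter]

/-- The support of a barycenter recovers its face, so `u` on faces becomes a map on vertices. -/
theorem geometricallyEmbeddable_barycentricSubdivision {d : ℕ}
    (u : Finset α → EuclideanSpace ℝ (Fin d))
    (hu : ∀ C D, IsFlag 𝓔 C → IsFlag 𝓔 D → UniqueConvexCombinations u C D) :
    GeometricallyEmbeddable (barycentricSubdivision 𝓔).toPreAbstractSimplicialComplex d := by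
  have himage : ∀ C : Set (Finset α), (fun x : α →₀ ℝ => u x.support) '' (bary '' C) = u '' C :=
    fun C => by simp [Set.image_image]
  refine ⟨fun x => u x.support, ?_, ?_⟩
  · rintro s ⟨-, C, hC, hsC⟩
    have hmem : ∀ x ∈ s, ∃ F ∈ C, bary F = x := fun x hx => by
      have : x ∈ (s : Set (α →₀ ℝ)) := hx
      rwa [hsC] at this
    refine (hu C C hC hC).affineIndependent.comp_embedding
      (⟨fun x : s => (⟨x.1.support, ?_⟩ : C), ?_⟩ : s ↪ C)
    · obtain ⟨F, hF, hx⟩ := hmem x x.2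
      simpa [← hx] using hF
    · rintro ⟨x, hx⟩ ⟨y, hy⟩ hxy
      obtain ⟨F, hF, rfl⟩ := hmem x hx
      obtain ⟨G, hG, rfl⟩ := hmem y hy
      simp only [support_bary, Subtype.mk.injEq] at hxy
      simp [hxy]
  · rintro s ⟨-, C, hC, hsC⟩ t ⟨-, D, hD, htD⟩
    rw [hsC, htD, ← Set.image_inter bary_injective, himage, himage, himage,
      (hu C D hC hD).convexHull_inter]

theorem exists_mem_convexHull_bary {F : Finset α} {x : α →₀ ℝ}
    (hx : x ∈ convexHull ℝ ((fun i => Finsupp.single i (1 : ℝ)) '' (F : Set α))) :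
    ∃ C : Set (Finset α), C.Nonempty ∧ IsFlag {F} C ∧ x ∈ convexHull ℝ (bary '' C) := by
  obtain ⟨h0, hs, h1⟩ := mem_convexHull_image_single_iff.1 hx
  obtain ⟨w, hw, hC, hwn, rfl⟩ := exists_linearCombination_bary x h0
  have hsum : (w.sum fun _ r => r) = 1 := by
    rw [← h1]
    -- The coordinate sum is linear and equals one on every barycenter.
    rw [sum_eq_linearCombination (Finsupp.linearCombination ℝ bary w)]
    simp only [Finsupp.linearCombination_apply ℝ w, Finsupp.sum, map_sum, map_smul]
    refine Finset.sum_congr rfl fun G hG => ?_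
    have hb := (mem_convexHull_image_single_iff.1
      (bary_mem_convexHull (hwn G hG).1 subset_rfl)).2.2
    rw [sum_eq_linearCombination] at hb
    rw [hb, smul_eq_mul, mul_one]
  refine ⟨w.support, ?_, ⟨hC, fun G hG => (hwn G hG).1, fun G hG => ⟨F, rfl, ?_⟩⟩,
    mem_convexHull_image_iff.2 ⟨w, hw, subset_rfl, hsum, rfl⟩⟩
  · refine Finset.coe_nonempty.2 (Finsupp.support_nonempty_iff.2 ?_)
    rintro rfl
    simp at hsum
  · exact (hwn G hG).2.trans (by exact_mod_cast hs)

theorem isSubdivision_barycentricSubdivision (K : PreAbstractSimplicialComplex α)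
    (hK : ∀ s, s ∈ K.faces ↔ s.Nonempty ∧ ∃ e ∈ 𝓔, s ⊆ e) :
    IsSubdivision (barycentricSubdivision 𝓔) (realization K) := by
  classical
  have hfaces : ∀ t, t ∈ (realization K).faces ↔ ∃ F ∈ K.faces,
      (t : Set (α →₀ ℝ)) = (fun i => Finsupp.single i (1 : ℝ)) '' (F : Set α) := by
    intro t
    have : t ∈ (realization K).faces ↔ ∃ F ∈ K.faces,
        (F.image fun i => Finsupp.single i (1 : ℝ)) = t := by
      simp only [realization, Geometry.SimplicialComplex.onFinsupp,
        Geometry.SimplicialComplex.ofAffineIndependent, PreAbstractSimplicialComplex.map,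
        Set.mem_image]
    rw [this]
    refine exists_congr fun F => and_congr_right fun _ => ?_
    rw [← Finset.coe_image, Finset.coe_inj, eq_comm]
  have hflag : ∀ {C : Set (Finset α)} {G : Finset α}, (∀ F ∈ C, F.Nonempty) → (∀ F ∈ C, F ⊆ G) →
      convexHull ℝ (bary '' C) ⊆
        convexHull ℝ ((fun i => Finsupp.single i (1 : ℝ)) '' (G : Set α)) := by
    rintro C G hn hG
    refine convexHull_min ?_ (convex_convexHull ℝ _)
    rintro _ ⟨F, hF, rfl⟩
    exact bary_mem_convexHull (hn F hF) (hG F hF)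
  refine ⟨?_, ?_⟩
  · rintro s ⟨hs, C, hC, hsC⟩
    have hCfin : C.Finite := Set.Finite.of_finite_image (hsC ▸ s.finite_toSet)
      bary_injective.injOn
    have hCne : C.Nonempty := by
      rw [← Set.image_nonempty, ← hsC]
      exact hs
    obtain ⟨G, hG, hmax⟩ := exists_max_of_isChain (C := hCfin.toFinset) (by simpa using hC.isChain)
      (by simpa using hCne)
    simp only [Set.Finite.mem_toFinset] at hG hmax
    refine ⟨G.image fun i => Finsupp.single i (1 : ℝ), (hfaces _).2 ⟨G, (hK G).2
      ⟨hC.nonempty G hG, hC.subset_edge G hG⟩, by simp⟩, ?_⟩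
    rw [hsC, Finset.coe_image]
    exact hflag hC.nonempty hmax
  · intro t ht
    obtain ⟨F, hF, htF⟩ := (hfaces t).1 ht
    obtain ⟨hFn, e, he, hFe⟩ := (hK F).1 hF
    -- The pieces of the simplex on `F` come from the flags of subsets of `F`.
    refine ⟨{s | s.Nonempty ∧ ∃ C, IsFlag {F} C ∧ (s : Set (α →₀ ℝ)) = bary '' C}, ?_, ?_, ?_⟩
    · refine (Finset.finite_toSet (F.powerset.image bary).powerset).subset ?_
      rintro s ⟨-, C, hC, hsC⟩
      rw [Finset.mem_coe, Finset.mem_powerset, ← Finset.coe_subset, hsC, Finset.coe_image]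
      refine Set.image_mono fun G hG => ?_
      obtain ⟨_, rfl, h⟩ := hC.subset_edge G hG
      simpa using h
    · rintro s ⟨hs, C, hC, hsC⟩
      refine ⟨hs, C, ⟨hC.isChain, hC.nonempty, fun G hG => ?_⟩, hsC⟩
      obtain ⟨_, rfl, h⟩ := hC.subset_edge G hG
      exact ⟨e, he, h.trans hFe⟩
    · rw [htF]
      apply subset_antisymm
      · intro x hx
        obtain ⟨C, hCne, hC, hxC⟩ := exists_mem_convexHull_bary hx
        have hCfin : C.Finite := by
          refine (Finset.finite_toSet F.powerset).subset fun G hG => ?_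
          obtain ⟨_, rfl, h⟩ := hC.subset_edge G hG
          simpa using h
        have hco : ((hCfin.image bary).toFinset : Set (α →₀ ℝ)) = bary '' C := by simp
        refine Set.mem_biUnion (x := (hCfin.image bary).toFinset) ⟨?_, C, hC, hco⟩ ?_
        · simpa using hCne
        · rwa [hco]
      · refine Set.iUnion₂_subset ?_
        rintro s ⟨-, C, hC, hsC⟩
        rw [hsC]
        refine hflag hC.nonempty fun G hG => ?_
        obtain ⟨_, rfl, h⟩ := hC.subset_edge G hG
        exact h

end Flags

/-! ### Projecting the spikes to `ℝ^d`. -/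

section Embedding

theorem exists_linearMap_injective_on_vectorSpan {E : Type*} [AddCommGroup E] [Module ℝ E] {d : ℕ}
    {𝓢 : Set (Set E)} (h𝓢 : 𝓢.Finite) (hfin : ∀ S ∈ 𝓢, S.Finite)
    (hd : ∀ S ∈ 𝓢, finrank ℝ (vectorSpan ℝ S) ≤ d) :
    ∃ T : E →ₗ[ℝ] EuclideanSpace ℝ (Fin d),
      ∀ S ∈ 𝓢, ∀ x ∈ vectorSpan ℝ S, T x = 0 → x = 0 := by
  have := h𝓢.to_subtype
  have (S : 𝓢) : FiniteDimensional ℝ (vectorSpan ℝ S.1) :=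
    finiteDimensional_vectorSpan_of_finite ℝ (hfin S S.2)
  obtain ⟨T, hT⟩ := exists_linearMap_injective_on d (fun S : 𝓢 => vectorSpan ℝ S.1)
    fun S => hd S S.2
  exact ⟨T, fun S hS => hT ⟨S, hS⟩⟩

variable {α : Type*} {𝓔 : Set (Finset α)}

theorem IsLinearFamily.affineIndependent (h𝓔 : IsLinearFamily 𝓔) {e f : Finset α} (he : e ∈ 𝓔)
    (hf : f ∈ 𝓔) (hef : e ≠ f) (hce : 4 ≤ e.card) (hcf : 4 ≤ f.card) {v w : α} (hvw : v ≠ w) :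
    AffineIndependent ℝ ![Finsupp.single v (1 : ℝ), Finsupp.single w 1, bary e, bary f] := by
  classical
  -- At most one of the four or more vertices of `e` lies in `f`, and two more are excluded. The
  -- coordinate at a remaining vertex detects `bary e` alone among the four points.
  have key : ∀ e ∈ 𝓔, ∀ f ∈ 𝓔, e ≠ f → 4 ≤ e.card → ∃ u ∈ e, u ∉ f ∧ u ≠ v ∧ u ≠ w := by
    intro e he f hf hef hce
    have h1 : (e ∩ f).card ≤ 1 := by
      by_contra! h
      exact hef (h𝓔 he hf h Finset.inter_subset_left Finset.inter_subset_right)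
    have h2 := Finset.card_sdiff_add_card_inter e f
    have h3 : ((e \ f) \ {v, w}).Nonempty := by
      rw [← Finset.card_pos]
      have := Finset.le_card_sdiff {v, w} (e \ f)
      have : ({v, w} : Finset α).card ≤ 2 := Finset.card_le_two
      omega
    obtain ⟨u, hu⟩ := h3
    simp only [Finset.mem_sdiff, Finset.mem_insert, Finset.mem_singleton, not_or] at hu
    exact ⟨u, hu.1.1, hu.1.2, hu.2⟩
  obtain ⟨a, hae, haf, hav, haw⟩ := key e he f hf hef hce
  obtain ⟨b, hbf, hbe, hbv, hbw⟩ := key f hf e he hef.symm hcf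
  refine LinearIndependent.affineIndependent ℝ (Fintype.linearIndependent_iff.2 fun g hg => ?_)
  simp only [Fin.sum_univ_four, Matrix.cons_val] at hg
  have h2 : g 2 = 0 := by
    have := DFunLike.congr_fun hg a
    simpa [hav, haw, bary_apply_of_notMem haf, (bary_pos hae).ne'] using this
  have h3 : g 3 = 0 := by
    have := DFunLike.congr_fun hg b
    simpa [hbv, hbw, bary_apply_of_notMem hbe, (bary_pos hbf).ne'] using this
  have h0 : g 0 = 0 := by
    have := DFunLike.congr_fun hg v
    simpa [h2, h3, hvw] using this
  have h1 : g 1 = 0 := by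
    have := DFunLike.congr_fun hg w
    simpa [h2, h3, hvw.symm] using this
  intro i
  fin_cases i <;> assumption

/-- A generic projection separates the simplices and the segments from their barycenters to
their vertices. -/
theorem exists_generic_projection {d : ℕ} (hd : 3 ≤ d) (hfin : 𝓔.Finite)
    (hcard : ∀ e ∈ 𝓔, e.card = d + 1) (h𝓔 : IsLinearFamily 𝓔) :
    ∃ T : (α →₀ ℝ) →ₗ[ℝ] EuclideanSpace ℝ (Fin d),
      (∀ e ∈ 𝓔, ∀ x ∈ vectorSpan ℝ ((fun i => Finsupp.single i (1 : ℝ)) '' (e : Set α)),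
        T x = 0 → x = 0) ∧
      ∀ e ∈ 𝓔, ∀ f ∈ 𝓔, e ≠ f → ∀ v ∈ e, ∀ w ∈ f, v ≠ w → AffineIndependent ℝ
        ![T (Finsupp.single v 1), T (Finsupp.single w 1), T (bary e), T (bary f)] := by
  classical
  have hV : (⋃ e ∈ 𝓔, (e : Set α)).Finite := hfin.biUnion fun e _ => e.finite_toSet
  set V : Set α := ⋃ e ∈ 𝓔, (e : Set α) with hVdef
  let Q : α × α × Finset α × Finset α → Set (α →₀ ℝ) := fun q => Set.range
    ![Finsupp.single q.1 (1 : ℝ), Finsupp.single q.2.1 1, bary q.2.2.1, bary q.2.2.2]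
  obtain ⟨T, hT⟩ := exists_linearMap_injective_on_vectorSpan (d := d)
    (𝓢 := (fun e : Finset α => (fun i => Finsupp.single i (1 : ℝ)) '' (e : Set α)) '' 𝓔 ∪
      Q '' (V ×ˢ V ×ˢ 𝓔 ×ˢ 𝓔))
    ((hfin.image _).union ((hV.prod (hV.prod (hfin.prod hfin))).image _))
    (by
      rintro _ (⟨e, -, rfl⟩ | ⟨q, -, rfl⟩)
      · exact e.finite_toSet.image _
      · exact Set.finite_range _)
    -- A simplex on `d + 1` vertices has dimension at most `d`; four points span dimension at most
    -- `3 ≤ d`.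
    (by
      rintro _ (⟨e, he, rfl⟩ | ⟨q, -, rfl⟩)
      · have := finrank_vectorSpan_image_finset_le ℝ (fun i => Finsupp.single i (1 : ℝ)) e
          (hcard e he)
        rwa [Finset.coe_image] at this
      · exact (finrank_vectorSpan_range_le ℝ _ (by simp)).trans hd)
  refine ⟨T, fun e he => hT _ (Or.inl ⟨e, he, rfl⟩), fun e he f hf hef v hv w hw hvw => ?_⟩
  have hQ := hT (Q (v, w, e, f)) (Or.inr ⟨_, ⟨Set.mem_biUnion he hv, Set.mem_biUnion hf hw, he, hf⟩,
    rfl⟩)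
  have := AffineIndependent.map_of_injective_on_vectorSpan (h𝓔.affineIndependent he hf hef
    (by rw [hcard e he]; omega) (by rw [hcard f hf]; omega) hvw) T hQ
  refine (congrArg (AffineIndependent ℝ) (funext fun i => ?_)).mp this
  fin_cases i <;> rfl

/-- Affine independence is an open condition and at `ε = 0` the points do not depend on `y`;
compactness makes the neighbourhood of zero uniform in `y`. -/
theorem eventually_affineIndependent {E : Type*} [NormedAddCommGroup E] [NormedSpace ℝ E]
    {p q c c' : E} (h : AffineIndependent ℝ ![p, q, c, c']) {A B : Set E} (hA : IsCompact A)
    (hB : IsCompact B) :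
    ∀ᶠ ε : ℝ in 𝓝 0, ∀ y ∈ A ×ˢ B, AffineIndependent ℝ
      ![p, q, (1 - ε) • c + ε • y.1, (1 - ε) • c' + ε • y.2] := by
  refine (hA.prod hB).eventually_forall_of_forall_eventually fun y _ => ?_
  have hcont : Continuous fun z : ℝ × E × E =>
      ![p, q, (1 - z.1) • c + z.1 • z.2.1, (1 - z.1) • c' + z.1 • z.2.2] := by
    refine continuous_pi fun i => ?_
    fin_cases i <;> simp <;> fun_prop
  refine hcont.continuousAt.eventually (p := fun x => AffineIndependent ℝ x)
    ((isOpen_setOfPred_affineIndependent (𝕜 := ℝ) (E := E) (ι := Fin 4)).mem_nhds ?_)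
  simpa using h

/-- A flag has at most one singleton `{v}`, whose spike is the vertex itself. All other spikes lie
in a copy of the simplex scaled by `ε` about its barycenter, so every point is on a segment from `v`
to that copy. -/
theorem spike_mem_of_isFlag (h𝓔 : IsLinearFamily 𝓔) (ε : ℝ) {C : Set (Finset α)}
    (hC : IsFlag 𝓔 C) {x : α →₀ ℝ} (hx : x ∈ convexHull ℝ (spike 𝓔 ε '' C)) :
    ∃ e ∈ 𝓔, ∃ v ∈ e, ∃ a : ℝ,
      ∃ z ∈ convexHull ℝ ((fun i => Finsupp.single i (1 : ℝ)) '' (e : Set α)), 0 ≤ a ∧ a ≤ 1 ∧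
        x = a • Finsupp.single v 1 + (1 - a) • ((1 - ε) • bary e + ε • z) := by
  obtain ⟨w, hw, hwC, hw1, rfl⟩ := mem_convexHull_image_iff.1 hx
  have hne : w.support.Nonempty := by
    refine Finsupp.support_nonempty_iff.2 ?_
    rintro rfl
    simp at hw1
  have hD := hC.mono hwC
  obtain ⟨G, hG, hmax⟩ := exists_max_of_isChain hD.isChain hne
  obtain ⟨e, he, hGe⟩ := hD.subset_edge G hG
  obtain ⟨v, hve, hv⟩ : ∃ v ∈ e, ∀ F ∈ w.support, F.card ≤ 1 → F = {v} := by
    by_cases h : ∃ F ∈ w.support, F.card ≤ 1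
    · obtain ⟨F, hF, hF1⟩ := h
      have hFc : F.card = 1 := le_antisymm hF1 (hD.nonempty F hF).card_pos
      obtain ⟨v, rfl⟩ := Finset.card_eq_one.1 hFc
      refine ⟨v, hGe (hmax _ hF (by simp)), fun F' hF' hF'1 => ?_⟩
      have hF'c : F'.card = 1 := le_antisymm hF'1 (hD.nonempty F' hF').card_pos
      rcases hD.isChain.total hF hF' with h | h
      · exact (Finset.eq_of_subset_of_card_le h (by omega)).symm
      · exact Finset.eq_of_subset_of_card_le h (by omega)
    · obtain ⟨v, hv⟩ := hD.nonempty G hG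
      -- Without a singleton, any vertex of `G` will do.
      exact ⟨v, hGe hv, fun F hF hF1 => absurd ⟨F, hF, hF1⟩ h⟩
  set Δ := convexHull ℝ ((fun i => Finsupp.single i (1 : ℝ)) '' (e : Set α)) with hΔ
  let B : Set (α →₀ ℝ) := (fun z => (1 - ε) • bary e + z) '' ((fun z => ε • z) '' Δ)
  have hB : Convex ℝ B := ((convex_convexHull ℝ _).smul ε).translate _
  have hBne : B.Nonempty := ⟨_, _, ⟨bary e, bary_mem_convexHull ⟨v, hve⟩ subset_rfl, rfl⟩, rfl⟩
  have hmem : Finsupp.linearCombination ℝ (spike 𝓔 ε) w ∈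
      convexHull ℝ (insert (Finsupp.single v 1) B) := by
    refine convexHull_mono ?_ (mem_convexHull_image_iff.2 ⟨w, hw, subset_rfl, hw1, rfl⟩)
    rintro _ ⟨F, hF, rfl⟩
    rcases le_or_gt F.card 1 with h | h
    · left
      rw [hv F hF h, spike, carrier_of_card_le (by simp), bary_singleton, ← add_smul]
      simp
    · right
      have hFe := (hmax F hF).trans hGe
      rw [spike, h𝓔.carrier_eq h he hFe]
      exact ⟨_, ⟨_, bary_mem_convexHull (hD.nonempty F hF) hFe, rfl⟩, rfl⟩
  rw [convexHull_insert hBne, hB.convexHull_eq, mem_convexJoin] at hmem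
  obtain ⟨_, rfl, _, ⟨_, ⟨z, hz, rfl⟩, rfl⟩, a, b, ha, hb, hab, h⟩ := hmem
  refine ⟨e, he, v, hve, a, z, hz, ha, by linarith, ?_⟩
  rw [← h, ← hab, add_sub_cancel_left]

theorem mem_convexHull_of_join {ε : ℝ} (h0 : 0 ≤ ε) (h1 : ε ≤ 1) {e : Finset α} {v : α} (hv : v ∈ e)
    {a : ℝ} (ha0 : 0 ≤ a) (ha1 : a ≤ 1) {z : α →₀ ℝ}
    (hz : z ∈ convexHull ℝ ((fun i => Finsupp.single i (1 : ℝ)) '' (e : Set α))) :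
    a • Finsupp.single v 1 + (1 - a) • ((1 - ε) • bary e + ε • z) ∈
      convexHull ℝ ((fun i => Finsupp.single i (1 : ℝ)) '' (e : Set α)) := by
  have hconv := convex_convexHull ℝ ((fun i => Finsupp.single i (1 : ℝ)) '' (e : Set α))
  refine hconv (subset_convexHull ℝ _ ⟨v, hv, rfl⟩) (hconv (bary_mem_convexHull ⟨v, hv⟩ subset_rfl)
    hz ?_ h0 ?_) ha0 ?_ ?_ <;> linarith

theorem exists_uniqueConvexCombinations {d : ℕ} (hd : 3 ≤ d) (hfin : 𝓔.Finite)
    (hcard : ∀ e ∈ 𝓔, e.card = d + 1) (h𝓔 : IsLinearFamily 𝓔) :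
    ∃ u : Finset α → EuclideanSpace ℝ (Fin d),
      ∀ C D, IsFlag 𝓔 C → IsFlag 𝓔 D → UniqueConvexCombinations u C D := by
  obtain ⟨T, hTe, hTq⟩ := exists_generic_projection hd hfin hcard h𝓔
  set Δ : Finset α → Set (α →₀ ℝ) :=
    fun e => convexHull ℝ ((fun i => Finsupp.single i (1 : ℝ)) '' (e : Set α)) with hΔ
  have hcompact : ∀ e, IsCompact (T '' Δ e) := fun e => by
    rw [hΔ, LinearMap.image_convexHull]
    exact ((e.finite_toSet.image _).image _).isCompact_convexHull ℝ
  have hev : ∀ᶠ ε : ℝ in 𝓝 0, ∀ e ∈ 𝓔, ∀ f ∈ 𝓔, ∀ v ∈ e, ∀ w ∈ f, e ≠ f → v ≠ w →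
      ∀ y ∈ (T '' Δ e) ×ˢ (T '' Δ f), AffineIndependent ℝ ![T (Finsupp.single v 1),
        T (Finsupp.single w 1), (1 - ε) • T (bary e) + ε • y.1, (1 - ε) • T (bary f) + ε • y.2] := by
    refine (eventually_all_finite hfin).2 fun e he => (eventually_all_finite hfin).2 fun f hf =>
      (eventually_all_finset e).2 fun v hv => (eventually_all_finset f).2 fun w hw =>
        eventually_imp_distrib_left.2 fun hef => eventually_imp_distrib_left.2 fun hvw => ?_
    exact eventually_affineIndependent (hTq e he f hf hef v hv w hw hvw) (hcompact e) (hcompact f)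
  obtain ⟨ε, hε, h0, h1⟩ : ∃ ε : ℝ, _ ∧ ε ∈ Set.Ioo 0 1 :=
    ((hev.filter_mono nhdsWithin_le_nhds).and (Ioo_mem_nhdsGT one_pos)).exists
  refine ⟨fun F => T (spike 𝓔 ε F), fun C D hC hD v w hv hvC hv1 hw hwD hw1 h => ?_⟩
  -- Weights are already unique before projection, so it suffices that `T` identifies no two
  -- distinct points of the spiked complex.
  refine hC.uniqueConvexCombinations_spike h0 h1.le h𝓔 hD v w hv hvC hv1 hw hwD hw1 ?_
  have hmap : ∀ y : Finset α →₀ ℝ, Finsupp.linearCombination ℝ (fun F => T (spike 𝓔 ε F)) y =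
      T (Finsupp.linearCombination ℝ (spike 𝓔 ε) y) := fun y => by
    simp [Finsupp.linearCombination_apply, Finsupp.sum]
  rw [hmap, hmap] at h
  obtain ⟨e, he, i, hi, a, y, hy, ha0, ha1, hx⟩ := spike_mem_of_isFlag h𝓔 ε hC
    (mem_convexHull_image_iff.2 ⟨v, hv, hvC, hv1, rfl⟩)
  obtain ⟨f, hf, j, hj, b, z, hz, hb0, hb1, hx'⟩ := spike_mem_of_isFlag h𝓔 ε hD
    (mem_convexHull_image_iff.2 ⟨w, hw, hwD, hw1, rfl⟩)
  rcases eq_or_ne e f with rfl | hef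
  · rw [← sub_eq_zero]
    refine hTe e he _ ?_ (by rw [map_sub, h, sub_self])
    rw [hx, hx']
    exact vsub_mem_vectorSpan_of_mem_affineSpan_of_mem_affineSpan
      (convexHull_subset_affineSpan _ (mem_convexHull_of_join h0.le h1.le hi ha0 ha1 hy))
      (convexHull_subset_affineSpan _ (mem_convexHull_of_join h0.le h1.le hj hb0 hb1 hz))
  rw [hx, hx'] at h ⊢
  simp only [map_add, map_smul] at h
  have hzero : ∀ k l : α, k ∈ e → l ∈ f → k ≠ l → ∀ g : Fin 4 → ℝ, ∑ m, g m = 0 →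
      g 0 • T (Finsupp.single k 1) + g 1 • T (Finsupp.single l 1) +
        g 2 • ((1 - ε) • T (bary e) + ε • T y) + g 3 • ((1 - ε) • T (bary f) + ε • T z) = 0 →
      ∀ m, g m = 0 := by
    intro k l hk hl hkl g hg0 hg m
    have := hε e he f hf k hk l hl hef hkl (T y, T z) ⟨⟨y, hy, rfl⟩, ⟨z, hz, rfl⟩⟩
    refine (affineIndependent_iff.1 this) Finset.univ g hg0 ?_ m (Finset.mem_univ m)
    simpa [Fin.sum_univ_four] using hg
  rcases eq_or_ne i j with rfl | hij
  -- With a common vertex, an auxiliary `l` of weight zero completes the quadruple; independence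
  -- forces `a = b = 1`, so both points are that vertex.
  · obtain ⟨l, hl, hil⟩ : ∃ l ∈ f, l ≠ i := Finset.exists_mem_ne (by rw [hcard f hf]; omega) i
    have := hzero i l hi hl hil.symm ![a - b, 0, 1 - a, -(1 - b)] (by
      simp [Fin.sum_univ_four]) (by
      simp only [Matrix.cons_val]
      rw [← sub_eq_zero] at h
      rw [← h]
      module)
    have h2 := this 2
    have h3 := this 3
    simp only [Matrix.cons_val] at h2 h3
    have ha : a = 1 := by linarith
    have hb : b = 1 := by linarith
    simp [ha, hb]
  -- With distinct vertices, independence would give both `a = 0` and `1 - a = 0`.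
  · have := hzero i j hi hj hij ![a, -b, 1 - a, -(1 - b)] (by
      simp [Fin.sum_univ_four]; ring) (by
      simp only [Matrix.cons_val]
      rw [← sub_eq_zero] at h
      rw [← h]
      module)
    have h0' := this 0
    have h2 := this 2
    simp only [Matrix.cons_val] at h0' h2
    linarith

end Embedding

end HypergraphPL

theorem lemma3p1 {α : Type*} (d : ℕ) (hd : 3 ≤ d) (H : Hypergraph α)
    (hfin : H.vertexSet.Finite)
    (huniform : HypergraphPL.IsUniform H (d + 1)) (hlinear : HypergraphPL.IsLinear H) :
    HypergraphPL.PLEmbeddable (HypergraphPL.complex H) d := by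
  set 𝓔 : Set (Finset α) := {e | (e : Set α) ∈ H.edgeSet} with h𝓔def
  have hE : H.edgeSet.Finite := hfin.finite_subsets.subset fun e he =>
    H.subset_vertexSet_of_mem_edgeSet' he
  have h𝓔fin : 𝓔.Finite := hE.preimage Finset.coe_injective.injOn
  have hcard : ∀ e ∈ 𝓔, e.card = d + 1 := fun e he => by
    have := huniform _ he
    rw [Set.encard_coe_eq_coe_finsetCard] at this
    exact_mod_cast this
  have hlin : HypergraphPL.IsLinearFamily 𝓔 := by
    intro e he f hf F hF hFe hFf
    by_contra hne
    have h1 := hlinear _ he _ hf (by simpa using hne)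
    have h2 : (F : Set α).encard ≤ 1 := (Set.encard_le_encard
      (Set.subset_inter (Finset.coe_subset.2 hFe) (Finset.coe_subset.2 hFf))).trans h1
    rw [Set.encard_coe_eq_coe_finsetCard] at h2
    exact hF.not_ge (by exact_mod_cast h2)
  obtain ⟨u, hu⟩ := HypergraphPL.exists_uniqueConvexCombinations hd h𝓔fin hcard hlin
  refine ⟨HypergraphPL.barycentricSubdivision 𝓔,
    HypergraphPL.isSubdivision_barycentricSubdivision _ fun s => ?_,
    HypergraphPL.geometricallyEmbeddable_barycentricSubdivision u hu⟩
  refine and_congr_right fun _ => ⟨?_, ?_⟩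
  · rintro ⟨e, he, hse⟩
    have hefin : e.Finite := hfin.subset (H.subset_vertexSet_of_mem_edgeSet' he)
    refine ⟨hefin.toFinset, by simpa [h𝓔def] using he, ?_⟩
    simpa [← Finset.coe_subset] using hse
  · rintro ⟨e, he, hse⟩
    exact ⟨e, he, Finset.coe_subset.2 hse⟩
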